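/- Let $p(z)=z^d+p_{d-1}z^{d-1}+\dots+p_1z$ be a monic polynomial with real coefficients, $p(0)=0$ and $\lambda=p'(0)>1$ (so $d\ge 2$), and put $\rho=\log_\lambda d$. Write $p^{(n)}$ for the $n$-th iterate of $p$ and $\mathcal F_\infty(p)=\{z\in\mathbb C: p^{(n)}(z)\to\infty\}$ for the basin of $\infty$. There is a Böttcher function $g$ of $p$ at $\infty$, that is, a function holomorphic near $\infty$ with $g(z)/z\to1$ as $z\to\infty$ and $g(z)^d=g(p(z))$ near $\infty$. It is invertible near $\infty$, and for some $R>0$ its inverse is given by a convergent Laurent series $$g^{(-1)}(w)=w+\sum_{n=0}^\infty \frac{c_n}{w^n}\qquad(|w|>R).$$ The coefficients $c_n$ are determined by the coefficients of $p$: each $c_n$ is a polynomial in the coefficients of $p$ with rational coefficients, and this polynomial depends only on $d$ and $n$. Let $f$ be the entire solution of the Poincaré equation $f(\lambda z)=p(f(z))$ with $f(0)=0$, $f'(0)=1$. Let $\alpha<\beta\le\alpha+2\pi$ and assume that the sector $W_{\alpha,\beta}=\{z\ne0:\alpha<\arg z<\beta\}$ is contained in $\mathcal F_\infty(p)$. On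 $W_{\alpha,\beta}$ let $\log z$ be the branch with $\alpha<\operatorname{Im}\log z<\beta$, and put $\log_\lambda z=\log z/\log\lambda$ and $z^\rho=e^{\rho\log z}$. Then there are a constant $\zeta$ with $\zeta^{d-1}=1$, where $\zeta=1$ if $W_{\alpha,\beta}$ meets the positive real axis, and a function $F$, periodic with period $1$ and holomorphic in the strip $\{u\in\mathbb C:\frac{\alpha}{\log\lambda}<\operatorname{Im}u<\frac{\beta}{\log\lambda}\}$, such that: 1. $\operatorname{Re}\, z^\rho F(\log_\lambda z)>0$ for all $z\in W_{\alpha,\beta}$. 2. For all $\alpha',\beta'$ with $\alpha<\alpha'\le\beta'<\beta$ and all sufficiently large $z$ with $\alpha'\le\arg z\le\beta'$, $$f(z)=\zeta\exp\bigl(z^\rho F(\log_\lambda z)\bigr)+\sum_{n=0}^\infty c_n\zeta^{-n}\exp\bigl(-n z^\rho F(\log_\lambda z)\bigr).$$ 3. For the same $z$, $\bigl|\zeta\exp(z^\rho F(\log_\lambda z))\bigr|>R$ and $$f(z)=g^{(-1)}\bigl(\zeta\exp(z^\rho F(\log_\lambda z))\bigr).$$ -/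

import Mathlib

open Polynomial

/-- The polynomial map `ℂ → ℂ` defined by a real polynomial. -/
noncomputable def polyMap (p : ℝ[X]) (z : ℂ) : ℂ := aeval z p

/-- The basin of `∞`: all `z` with `p^(n)(z) → ∞`. -/
def basinInfty (p : ℝ[X]) : Set ℂ :=
  {z | Filter.Tendsto (fun n : ℕ => (polyMap p)^[n] z) Filter.atTop (Bornology.cobounded ℂ)}

/-- The open strip `a < Im s < b`. -/
def hStrip (a b : ℝ) : Set ℂ := {s | a < s.im ∧ s.im < b}

/-- The open sector `W_{α,β}`: the nonzero `z` having an argument in `(α, β)`. A point `s` of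
`hStrip α β` with `exp s = z` is a logarithm of `z` whose imaginary part is such an argument. -/
def sector (α β : ℝ) : Set ℂ := {z | ∃ s ∈ hStrip α β, Complex.exp s = z}

/-- `f` is the normalised entire solution of the Poincaré equation `f(λ z) = p(f(z))`,
where `λ = p'(0)`. -/
structure IsPoincareFunction (p : ℝ[X]) (f : ℂ → ℂ) : Prop where
  entire : Differentiable ℂ f
  map_zero : f 0 = 0
  deriv_zero : deriv f 0 = 1
  funEq : ∀ z : ℂ, f (((p.derivative.eval 0 : ℝ) : ℂ) * z) = polyMap p (f z)

/-- `g` is the Böttcher function of the monic polynomial `p` at `∞`: holomorphic near `∞`,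
tangent to the identity there, with `g(z)^d = g(p(z))` near `∞`. -/
structure IsBoettcherFunction (p : ℝ[X]) (g : ℂ → ℂ) : Prop where
  holomorphic : ∃ R : ℝ, DifferentiableOn ℂ g {z | R < ‖z‖}
  tangent : Filter.Tendsto (fun z => g z / z) (Bornology.cobounded ℂ) (nhds 1)
  funEq : ∀ᶠ z in Bornology.cobounded ℂ, g z ^ p.natDegree = g (polyMap p z)

/-! Write z = e^s and l = log λ, so that multiplication by λ becomes translation by l and the sector
becomes a strip. Wherever f(e^s) is large, h(s) = g(f(e^s)) satisfies h(s + l) = h(s)^d, by the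
Poincaré and Böttcher equations together. Formally log h solves the linear equation Ψ(s + l) =
dΨ(s). As λ^ρ = d, the function e^(ρs) solves it too, so Ψ(s)e^(-ρs) has period l; this is F after
rescaling. Applying the inverse of g to h = ζe^Ψ gives the expansion of f.

For this, h must be defined far to the right in every closed substrip. The basin hypothesis
transfers to f(e^s), because f is tangent to the identity at 0 (`exp_mem_basinInfty`), and
compactness of a fundamental rectangle makes the growth uniform (`exists_lt_norm`). The branch of
log h is avoided by integrating h'/h, which extends to the whole strip through its own functional
equation (`exists_log_of_functional_equation`). The integration constant is absorbed except for a
factor ζ, and the equation for h forces ζ^(d-1) = 1. If the sector meets the positive axis, then h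
is eventually positive on a horizontal line. There Im Ψ is eventually constant yet multiplied by d
under translation, so it vanishes and ζ = 1 (`exists_const_mul_exp`).

The Böttcher function comes from its explicit logarithmic series in the coordinate 1/z. The Laurent
coefficients of its inverse are universal because the inverse solves a functional equation whose
solution is found by an iteration with polynomial coefficients (`boettcherApprox`), gaining one
correct order per step. -/

open Filter Topology Metric ComplexConjugate Bornology Asymptotics

/-! ### Böttcher coordinate at a superattracting fixed point -/

/-- Existence of a Böttcher coordinate at the superattracting fixed point `0` of the map
`t ↦ t ^ d / q t`, where `q 0 = 1`. -/
theorem exists_boettcher_at_zero {d : ℕ} (hd : 2 ≤ d) {q : ℂ → ℂ} (hq : AnalyticAt ℂ q 0)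
    (hq0 : q 0 = 1) :
    ∃ G : ℂ → ℂ, AnalyticAt ℂ G 0 ∧ G 0 = 0 ∧ deriv G 0 = 1 ∧
      (∀ᶠ t in 𝓝 0, G (t ^ d / q t) = G t ^ d) ∧
      ((∀ t, q (conj t) = conj (q t)) → ∀ᶠ t in 𝓝 0, G (conj t) = conj (G t)) := by
  have hQ : AnalyticAt ℂ (fun t => (q t)⁻¹) 0 := hq.inv (by simp [hq0])
  have hev : ∀ᶠ t in 𝓝 (0 : ℂ), AnalyticAt ℂ (fun t => (q t)⁻¹) t ∧ ‖(q t)⁻¹ - 1‖ < 1 / 2 := by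
    refine hQ.eventually_analyticAt.and ?_
    have : ContinuousAt (fun t => ‖(q t)⁻¹ - 1‖) 0 := (hQ.continuousAt.sub continuousAt_const).norm
    exact this.eventually_lt continuousAt_const (by simp [hq0])
  obtain ⟨r₀, hr₀, hball₀⟩ := Metric.eventually_nhds_iff_ball.1 hev
  -- On this ball |1/q - 1| < 1/2 keeps 1/q in the slit plane with bounded logarithm, and |t| ≤ 1/2
  -- gives |P t| ≤ (3/2)|t|² ≤ |t|, so the ball is invariant.
  obtain ⟨r, hr, hr2, hball⟩ : ∃ r : ℝ, 0 < r ∧ r ≤ 1 / 2 ∧ ∀ t ∈ ball (0 : ℂ) r,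
      AnalyticAt ℂ (fun t => (q t)⁻¹) t ∧ ‖(q t)⁻¹ - 1‖ < 1 / 2 :=
    ⟨min r₀ (1 / 2), by positivity, min_le_right _ _,
      fun t ht => hball₀ t (ball_subset_ball (min_le_left _ _) ht)⟩
  set Q : ℂ → ℂ := fun t => (q t)⁻¹ with hQdef
  set P : ℂ → ℂ := fun t => t ^ d * Q t with hP
  set B : Set ℂ := ball 0 r with hB
  have hBo : IsOpen B := isOpen_ball
  have hB0 : (0 : ℂ) ∈ B := mem_ball_self hr
  have hBn : B ∈ 𝓝 (0 : ℂ) := hBo.mem_nhds hB0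
  have hQd : DifferentiableOn ℂ Q B := fun t ht =>
    (hball t ht).1.differentiableAt.differentiableWithinAt
  have hQs : ∀ t ∈ B, Q t ∈ Complex.slitPlane := fun t ht => by
    have h1 := (hball t ht).2
    have h2 : |(Q t - 1).re| < 1 / 2 := (Complex.abs_re_le_norm _).trans_lt h1
    rw [abs_lt] at h2
    simp only [Complex.sub_re, Complex.one_re] at h2
    exact Or.inl (by linarith)
  have hmaps : Set.MapsTo P B B := fun t ht => by
    have h1 := (hball t ht).2
    have h3 : ‖Q t‖ ≤ 3 / 2 := by
      calc ‖Q t‖ = ‖(Q t - 1) + 1‖ := by ring_nf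
        _ ≤ ‖Q t - 1‖ + ‖(1 : ℂ)‖ := norm_add_le _ _
        _ ≤ 3 / 2 := by rw [norm_one]; linarith
    have ht' : ‖t‖ < r := by simpa [hB] using ht
    have h4 : ‖t‖ ^ d ≤ ‖t‖ ^ 2 := pow_le_pow_of_le_one (norm_nonneg _) (by linarith) hd
    have : ‖P t‖ < r := by
      calc ‖P t‖ = ‖t‖ ^ d * ‖Q t‖ := by simp [hP]
        _ ≤ ‖t‖ ^ 2 * (3 / 2) := by gcongr
        _ ≤ ‖t‖ := by nlinarith [norm_nonneg t]
        _ < r := ht'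
    simpa [hB] using this
  have hPd : DifferentiableOn ℂ P B := (differentiableOn_id.pow d).mul hQd
  have hit : ∀ k, Set.MapsTo P^[k] B B := fun k => hmaps.iterate k
  have hd0 : (d : ℂ) ≠ 0 := by exact_mod_cast (by omega : d ≠ 0)
  -- Formally G(t) is the limit of (P^k t)^(1/d^k). Since P t = t^d Q t, the logarithm of G(t)/t
  -- telescopes to the series of these terms.
  set T : ℕ → ℂ → ℂ := fun k t => ((d : ℂ)⁻¹) ^ (k + 1) * Complex.log (Q (P^[k] t)) with hT
  have hTd : ∀ k, DifferentiableOn ℂ (T k) B := fun k =>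
    (((hQd.comp (hPd.iterate hmaps k) (hit k)).clog
      (fun t ht => hQs _ (hit k ht)))).const_mul _
  have hTb : ∀ k, ∀ t ∈ B, ‖T k t‖ ≤ (1 / 2 : ℝ) ^ k := fun k t ht => by
    have h1 := (hball _ (hit k ht)).2
    have h2 : ‖Complex.log (Q (P^[k] t))‖ ≤ 1 := by
      have := Complex.norm_log_one_add_half_le_self (z := Q (P^[k] t) - 1) h1.le
      rw [add_sub_cancel] at this
      linarith
    have hdr : (2 : ℝ) ≤ d := by exact_mod_cast hd
    have h3 : ‖(d : ℂ)⁻¹‖ ≤ 1 / 2 := by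
      rw [norm_inv, Complex.norm_natCast, one_div]
      exact inv_anti₀ (by norm_num) hdr
    calc ‖T k t‖ = ‖(d : ℂ)⁻¹‖ ^ (k + 1) * ‖Complex.log (Q (P^[k] t))‖ := by simp [hT]
      _ ≤ (1 / 2) ^ (k + 1) * 1 := by gcongr
      _ ≤ (1 / 2) ^ k := by rw [pow_succ]; nlinarith [pow_pos (one_half_pos (α := ℝ)) k]
  have hsum : Summable fun k : ℕ => (1 / 2 : ℝ) ^ k := summable_geometric_two
  set S : ℂ → ℂ := fun t => ∑' k, T k t with hS
  have hSd : DifferentiableOn ℂ S B :=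
    Complex.differentiableOn_tsum_of_summable_norm hsum hTd hBo hTb
  have hTs : ∀ t ∈ B, Summable fun k => T k t := fun t ht =>
    Summable.of_norm_bounded hsum fun k => hTb k t ht
  have hSP : ∀ t ∈ B, S (P t) = d * S t - Complex.log (Q t) := fun t ht => by
    have h1 : S t = T 0 t + ∑' k, T (k + 1) t := (hTs t ht).tsum_eq_zero_add
    have h2 : S (P t) = d * ∑' k, T (k + 1) t := by
      rw [hS, ← tsum_mul_left]
      refine tsum_congr fun k => ?_
      simp only [hT, Function.iterate_succ_apply]
      rw [pow_succ _ (k + 1)]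
      field_simp
    rw [h2, h1]
    simp only [hT, zero_add, pow_one, Function.iterate_zero, id]
    field_simp
    ring
  have hSa : AnalyticAt ℂ S 0 := hSd.analyticAt hBn
  have hQ00 : Q 0 = 1 := by simp [hQdef, hq0]
  have hS0 : S 0 = 0 := by
    have hP0 : ∀ k, P^[k] 0 = 0 := fun k => Function.iterate_fixed (by simp [hP]; omega) k
    simp [hS, hT, hP0, hQ00]
  refine ⟨fun t => t * Complex.exp (S t), analyticAt_id.mul hSa.cexp, by simp, ?_, ?_, ?_⟩
  · have := (hasDerivAt_id (0 : ℂ)).mul hSa.differentiableAt.hasDerivAt.cexp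
    have h := this.deriv
    simp only [id, hS0, Complex.exp_zero, one_mul, zero_mul, add_zero] at h
    exact h
  · filter_upwards [hBn] with t ht
    have h1 : t ^ d / q t = P t := by simp [hP, hQdef, div_eq_mul_inv]
    have h2 : Q t ≠ 0 := Complex.slitPlane_ne_zero (hQs t ht)
    rw [h1, hSP t ht, Complex.exp_sub, Complex.exp_log h2, mul_pow, ← Complex.exp_nat_mul]
    simp only [hP]
    field_simp
  · intro hconj
    have hQc : ∀ t, Q (conj t) = conj (Q t) := fun t => by simp [hQdef, hconj]
    have hPc : ∀ k t, P^[k] (conj t) = conj (P^[k] t) := fun k => by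
      induction k with
      | zero => simp
      | succ k ih =>
        intro t
        have : P (conj t) = conj (P t) := by simp [hP, hQc]
        rw [Function.iterate_succ_apply, Function.iterate_succ_apply, this, ih]
    filter_upwards [hBn] with t ht
    have : S (conj t) = conj (S t) := by
      simp only [hS, Complex.conj_tsum]
      refine tsum_congr fun k => ?_
      simp only [hT, hPc, hQc, map_mul, map_pow, map_inv₀, map_natCast]
      rw [Complex.log_conj _ (Complex.slitPlane_arg_ne_pi (hQs _ (hit k ht)))]
    simp [this, ← Complex.exp_conj]

/-! ### Universal polynomials for the Laurent coefficients -/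

/-- Polynomial approximations in `t` of the solution `u` of `u(t^d) = ∑ k ≤ d, X_k t^(d-k) u(t)^k`
with `u(0) = 1`, the `X_k` being indeterminates. -/
noncomputable def boettcherApprox (d : ℕ) : ℕ → Polynomial (MvPolynomial ℕ ℚ)
  | 0 => 1
  | m + 1 => boettcherApprox d m + C (MvPolynomial.C (d : ℚ)⁻¹) *
      ((boettcherApprox d m).comp (X ^ d) -
        ∑ k ∈ Finset.range (d + 1), C (MvPolynomial.X k) * X ^ (d - k) * boettcherApprox d m ^ k)

/-- The value at `t` of the `m`-th approximation, with the numbers `a k` for the indeterminates. -/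
noncomputable def boettcherApproxEval (a : ℕ → ℂ) (d m : ℕ) (t : ℂ) : ℂ :=
  ((boettcherApprox d m).map (MvPolynomial.aeval a).toRingHom).eval t

theorem boettcherApproxEval_zero (a : ℕ → ℂ) (d : ℕ) (t : ℂ) : boettcherApproxEval a d 0 t = 1 := by
  simp [boettcherApproxEval, boettcherApprox]

theorem boettcherApproxEval_succ (a : ℕ → ℂ) (d m : ℕ) (t : ℂ) :
    boettcherApproxEval a d (m + 1) t = boettcherApproxEval a d m t +
      (d : ℂ)⁻¹ * (boettcherApproxEval a d m (t ^ d) -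
        ∑ k ∈ Finset.range (d + 1), a k * t ^ (d - k) * boettcherApproxEval a d m t ^ k) := by
  simp [boettcherApproxEval, boettcherApprox, Polynomial.map_comp, Polynomial.eval_finsetSum,
    Polynomial.map_sum]

/-- Each approximation is a Newton step with the derivative frozen at its value d at t = 0. The sums
for u and for U differ by (u - U)D with D(0) = d, since only k = d survives at t = 0 and a_d = 1.
The new error is therefore (u - U)(1 - D/d) + (u - U)(t^d)/d. The first term gains a factor t, and
the second has order d(m + 1) ≥ m + 2. -/
theorem isBigO_sub_boettcherApproxEval {a : ℕ → ℂ} {d : ℕ} (hd : 2 ≤ d) (had : a d = 1)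
    {u : ℂ → ℂ} (hu : AnalyticAt ℂ u 0) (hu0 : u 0 = 1)
    (hfe : ∀ᶠ t in 𝓝 0, u (t ^ d) = ∑ k ∈ Finset.range (d + 1), a k * t ^ (d - k) * u t ^ k)
    (m : ℕ) :
    (fun t => u t - boettcherApproxEval a d m t) =O[𝓝 0] fun t => t ^ (m + 1) := by
  have hd0 : (d : ℂ) ≠ 0 := by exact_mod_cast (by omega : d ≠ 0)
  have hUa : ∀ m, AnalyticAt ℂ (boettcherApproxEval a d m) 0 := fun m =>
    (Polynomial.differentiable _).analyticAt 0
  induction m with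
  | zero =>
    have := hu.differentiableAt.isBigO_sub
    simpa [boettcherApproxEval_zero, hu0] using this
  | succ m ih =>
    set U := boettcherApproxEval a d m with hU
    have hU0 : U 0 = 1 := by
      have := ih.eq_zero_imp.self_of_nhds (by simp)
      rw [hu0] at this
      linear_combination -this
    set D : ℂ → ℂ := fun t => ∑ k ∈ Finset.range (d + 1), a k * t ^ (d - k) *
      ∑ i ∈ Finset.range k, u t ^ i * U t ^ (k - 1 - i) with hD
    have hDa : AnalyticAt ℂ D 0 := by
      have := hUa m
      rw [← hU] at this
      refine Finset.analyticAt_fun_sum _ fun k _ => ?_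
      refine (analyticAt_const.mul (analyticAt_id.pow _)).mul ?_
      exact Finset.analyticAt_fun_sum _ fun i _ => (hu.pow _).mul (this.pow _)
    have hD0 : D 0 = d := by
      simp only [hD, hu0, hU0, one_pow]
      rw [Finset.sum_eq_single d]
      · simp [had]
      · intro k hk hkd
        have : d - k ≠ 0 := by have := Finset.mem_range.1 hk; omega
        simp [this]
      · simp
    have h1 : (fun t => 1 - (d : ℂ)⁻¹ * D t) =O[𝓝 0] fun t => t := by
      have h := (analyticAt_const.sub (analyticAt_const.mul hDa)
        : AnalyticAt ℂ (fun t => 1 - (d : ℂ)⁻¹ * D t) 0).differentiableAt.isBigO_sub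
      simpa [hD0, hd0] using h
    have htd : Tendsto (fun t : ℂ => t ^ d) (𝓝 0) (𝓝 0) := by
      have : ContinuousAt (fun t : ℂ => t ^ d) 0 := (continuous_pow d).continuousAt
      simpa [ContinuousAt, zero_pow (by omega : d ≠ 0)] using this
    have h2 : (fun t => u (t ^ d) - U (t ^ d)) =O[𝓝 0] fun t => t ^ (m + 1 + 1) := by
      refine (ih.comp_tendsto htd).trans ?_
      simp only [Function.comp_def, ← pow_mul]
      obtain ⟨j, hj⟩ : ∃ j, d * (m + 1) = m + 1 + 1 + j := Nat.exists_eq_add_of_le (by nlinarith)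
      rw [hj]
      simp only [pow_add _ (m + 1 + 1)]
      simpa using (isBigO_refl (fun t : ℂ => t ^ (m + 1 + 1)) (𝓝 0)).mul
        ((continuous_pow j).continuousAt (x := (0 : ℂ)) |>.isBigO_one (F := ℂ))
    have h3 : (fun t => (u t - U t) * (1 - (d : ℂ)⁻¹ * D t) +
        (d : ℂ)⁻¹ * (u (t ^ d) - U (t ^ d))) =O[𝓝 0] fun t => t ^ (m + 1 + 1) := by
      refine IsBigO.add ?_ (h2.const_mul_left _)
      simpa [pow_succ] using ih.mul h1
    refine h3.congr' ?_ EventuallyEq.rfl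
    filter_upwards [hfe] with t ht
    rw [boettcherApproxEval_succ, ← hU]
    have h4 : (u t - U t) * D t = ∑ k ∈ Finset.range (d + 1), a k * t ^ (d - k) * u t ^ k -
        ∑ k ∈ Finset.range (d + 1), a k * t ^ (d - k) * U t ^ k := by
      rw [hD, Finset.mul_sum, ← Finset.sum_sub_distrib]
      refine Finset.sum_congr rfl fun k _ => ?_
      have := (Commute.all (u t) (U t)).geom_sum₂_mul k
      linear_combination a k * t ^ (d - k) * this
    rw [ht]
    linear_combination -(d : ℂ)⁻¹ * h4

/-- The induction divides by t, which is why the estimate is taken on the punctured neighbourhood.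
-/
theorem Polynomial.coeff_eq_zero_of_isBigO {n : ℕ} : ∀ {r : ℂ[X]},
    (fun t => r.eval t) =O[𝓝[≠] 0] (fun t => t ^ (n + 1)) → ∀ k ≤ n, r.coeff k = 0 := by
  have key : ∀ (m : ℕ) (r : ℂ[X]),
      (fun t => r.eval t) =O[𝓝[≠] 0] (fun t => t ^ (m + 1)) → r.coeff 0 = 0 := by
    intro m r h
    have h1 : Tendsto (fun t => r.eval t) (𝓝[≠] (0 : ℂ)) (𝓝 0) := by
      refine h.trans_tendsto ?_
      have : ContinuousAt (fun t : ℂ => t ^ (m + 1)) 0 := (continuous_pow _).continuousAt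
      simpa [ContinuousAt] using this.tendsto.mono_left nhdsWithin_le_nhds
    have h2 : Tendsto (fun t => r.eval t) (𝓝[≠] (0 : ℂ)) (𝓝 (r.eval 0)) :=
      r.continuous.continuousAt.tendsto.mono_left nhdsWithin_le_nhds
    rw [coeff_zero_eq_eval_zero]
    exact tendsto_nhds_unique h2 h1
  induction n with
  | zero =>
    intro r h k hk
    obtain rfl : k = 0 := by omega
    exact key 0 r h
  | succ n ih =>
    intro r h k hk
    have h0 := key _ r h
    cases k with
    | zero => exact h0
    | succ k =>
      rw [← coeff_divX]
      refine ih ?_ k (by omega)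
      have hr := divX_mul_X_add r
      rw [h0, C_0, add_zero] at hr
      have h3 := h.mul (isBigO_refl (fun t : ℂ => t⁻¹) (𝓝[≠] 0))
      refine h3.congr' ?_ ?_
      · filter_upwards [self_mem_nhdsWithin] with t ht
        have ht : t ≠ 0 := ht
        have := congrArg (eval t) hr
        rw [eval_mul, eval_X] at this
        rw [← this, mul_inv_cancel_right₀ ht]
      · filter_upwards [self_mem_nhdsWithin] with t ht
        have ht : t ≠ 0 := ht
        rw [pow_succ, mul_inv_cancel_right₀ ht]

/-- The n-th approximation agrees with u up to an error O(t^(n+1)), so its n-th coefficient already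
is the n-th Taylor coefficient of u. -/
theorem hasSum_boettcherApprox {a : ℕ → ℂ} {d : ℕ} (hd : 2 ≤ d) (had : a d = 1)
    {u : ℂ → ℂ} (hu : AnalyticAt ℂ u 0) (hu0 : u 0 = 1)
    (hfe : ∀ᶠ t in 𝓝 0, u (t ^ d) = ∑ k ∈ Finset.range (d + 1), a k * t ^ (d - k) * u t ^ k) :
    ∀ᶠ t in 𝓝 0,
      HasSum (fun n => MvPolynomial.aeval a ((boettcherApprox d n).coeff n) * t ^ n) (u t) := by
  obtain ⟨ps, hps⟩ := hu
  have hcoeff : ∀ n, ps.coeff n = MvPolynomial.aeval a ((boettcherApprox d n).coeff n) := by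
    intro n
    set V := (boettcherApprox d n).map (MvPolynomial.aeval a).toRingHom with hV
    set r : ℂ[X] := ∑ k ∈ Finset.range (n + 1), C (ps.coeff k) * X ^ k - V with hr
    have h1 := isBigO_sub_boettcherApproxEval hd had ⟨ps, hps⟩ hu0 hfe n
    have h2 : (fun t => u (0 + t) - ps.partialSum (n + 1) t) =O[𝓝 0] fun t => t ^ (n + 1) := by
      have := hps.isBigO_sub_partialSum_pow (n + 1)
      simp only [← norm_pow] at this
      exact this.of_norm_right
    have h3 : (fun t => r.eval t) =O[𝓝[≠] 0] (fun t => t ^ (n + 1)) := by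
      refine ((h1.sub h2).mono nhdsWithin_le_nhds).congr_left fun t => ?_
      have e1 : boettcherApproxEval a d n t = V.eval t := rfl
      have e2 : ps.partialSum (n + 1) t = ∑ k ∈ Finset.range (n + 1), ps.coeff k * t ^ k :=
        Finset.sum_congr rfl fun k _ => by
          rw [FormalMultilinearSeries.apply_eq_pow_smul_coeff, smul_eq_mul, mul_comm]
      rw [hr, eval_sub, eval_finsetSum, e1, e2, zero_add]
      simp only [eval_mul, eval_C, eval_pow, eval_X]
      ring
    have h4 := Polynomial.coeff_eq_zero_of_isBigO h3 n le_rfl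
    have h5 : V.coeff n = MvPolynomial.aeval a ((boettcherApprox d n).coeff n) := coeff_map _ _
    rw [hr, coeff_sub, finsetSum_coeff, h5, Finset.sum_eq_single n] at h4
    · simpa [sub_eq_zero] using h4
    · intro k _ hk
      simp [coeff_X_pow, hk.symm]
    · simp
  obtain ⟨r, hr⟩ := hps
  filter_upwards [Metric.eball_mem_nhds (0 : ℂ) hr.r_pos] with t ht
  have := hr.hasSum ht
  simpa [hcoeff, mul_comm] using this

/-! ### Local inversion and the Böttcher function at infinity -/

theorem AnalyticAt.exists_local_inverse {G : ℂ → ℂ} (hG : AnalyticAt ℂ G 0) (hG0 : G 0 = 0)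
    (hG1 : deriv G 0 = 1) :
    ∃ H : ℂ → ℂ, AnalyticAt ℂ H 0 ∧ H 0 = 0 ∧ deriv H 0 = 1 ∧ (∀ᶠ t in 𝓝 0, H (G t) = t) ∧
      ∀ᶠ s in 𝓝 0, G (H s) = s := by
  have hG' : deriv G 0 ≠ 0 := by simp [hG1]
  have hs := hG.hasStrictDerivAt
  have h1 := hG.analyticAt_localInverse hG'
  have h2 := hs.to_localInverse hG'
  have h3 := hs.hasStrictFDerivAt_equiv hG'
  rw [hG0] at h1 h2
  refine ⟨hs.localInverse _ _ _ hG', h1, ?_, ?_, ?_, ?_⟩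
  · have := h3.localInverse_apply_image
    rw [hG0] at this
    exact this
  · rw [h2.hasDerivAt.deriv, hG1, inv_one]
  · exact h3.eventually_left_inverse
  · have := h3.eventually_right_inverse
    rw [hG0] at this
    exact this

theorem AnalyticAt.exists_eq_mul {H : ℂ → ℂ} (hH : AnalyticAt ℂ H 0) (hH0 : H 0 = 0) :
    ∃ k : ℂ → ℂ, AnalyticAt ℂ k 0 ∧ k 0 = deriv H 0 ∧ ∀ s, H s = s * k s := by
  obtain ⟨ps, hps⟩ := hH
  refine ⟨dslope H 0, ⟨_, hps.has_fpower_series_dslope_fslope⟩, dslope_same H 0, fun s => ?_⟩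
  have := sub_smul_dslope H 0 s
  simpa [hH0] using this.symm

/-- The polynomial `p` read in the coordinate `1 / z`: `p z = z ^ d * reversePoly p (1 / z)`. -/
noncomputable def reverseMap (p : ℝ[X]) (t : ℂ) : ℂ :=
  ∑ k ∈ Finset.range (p.natDegree + 1), ((p.coeff k : ℝ) : ℂ) * t ^ (p.natDegree - k)

theorem polyMap_eq_sum (p : ℝ[X]) (z : ℂ) :
    polyMap p z = ∑ k ∈ Finset.range (p.natDegree + 1), ((p.coeff k : ℝ) : ℂ) * z ^ k := by
  rw [polyMap, aeval_eq_sum_range]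
  simp

theorem polyMap_eq_pow_mul_reverseMap (p : ℝ[X]) {z : ℂ} (hz : z ≠ 0) :
    polyMap p z = z ^ p.natDegree * reverseMap p z⁻¹ := by
  rw [polyMap_eq_sum, reverseMap, Finset.mul_sum]
  refine Finset.sum_congr rfl fun k hk => ?_
  have hk : k ≤ p.natDegree := by have := Finset.mem_range.1 hk; omega
  have : z ^ p.natDegree = z ^ k * z ^ (p.natDegree - k) := by rw [← pow_add]; congr 1; omega
  rw [this, inv_pow]
  field_simp

theorem analyticAt_reverseMap (p : ℝ[X]) (t : ℂ) : AnalyticAt ℂ (reverseMap p) t :=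
  Finset.analyticAt_fun_sum _ fun _ _ => analyticAt_const.mul (analyticAt_id.pow _)

theorem reverseMap_zero {p : ℝ[X]} (hp : p.Monic) : reverseMap p 0 = 1 := by
  rw [reverseMap, Finset.sum_eq_single p.natDegree]
  · simp [hp]
  · intro k hk hkd
    have : p.natDegree - k ≠ 0 := by have := Finset.mem_range.1 hk; omega
    simp [this]
  · simp

theorem reverseMap_conj (p : ℝ[X]) (t : ℂ) : reverseMap p (conj t) = conj (reverseMap p t) := by
  simp [reverseMap]

theorem polyMap_conj (p : ℝ[X]) (z : ℂ) : polyMap p (conj z) = conj (polyMap p z) := by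
  simp [polyMap_eq_sum]

/-- The inverse Böttcher function, in the coordinate `1 / w`, solves the functional equation
behind `boettcherApprox`. -/
theorem eventually_inverse_functional_equation {p : ℝ[X]} (hp : p.Monic) (hd : 2 ≤ p.natDegree)
    {G H k : ℂ → ℂ}
    (hG : ∀ᶠ t in 𝓝 0, G (t ^ p.natDegree / reverseMap p t) = G t ^ p.natDegree)
    (hH : AnalyticAt ℂ H 0) (hH0 : H 0 = 0) (hHG : ∀ᶠ t in 𝓝 0, H (G t) = t)
    (hGH : ∀ᶠ s in 𝓝 0, G (H s) = s) (hk : AnalyticAt ℂ k 0) (hk0 : k 0 = 1)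
    (hHk : ∀ s, H s = s * k s) :
    ∀ᶠ t in 𝓝 0, (k (t ^ p.natDegree))⁻¹ = ∑ j ∈ Finset.range (p.natDegree + 1),
      ((p.coeff j : ℝ) : ℂ) * t ^ (p.natDegree - j) * (k t)⁻¹ ^ j := by
  set d := p.natDegree with hdd
  have hd0 : d ≠ 0 := by omega
  have hHt : Tendsto H (𝓝 0) (𝓝 0) := by simpa [ContinuousAt, hH0] using hH.continuousAt
  have hP : Tendsto (fun t => t ^ d / reverseMap p t) (𝓝 0) (𝓝 0) := by
    have h := ((continuous_pow d).continuousAt (x := (0 : ℂ))).div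
      (analyticAt_reverseMap p 0).continuousAt (by simp [reverseMap_zero hp])
    simpa [ContinuousAt, hd0, Pi.div_def] using h
  have hkne : ∀ᶠ t in 𝓝 0, k t ≠ 0 := hk.continuousAt.eventually_ne (by simp [hk0])
  have hpow : Tendsto (fun t : ℂ => t ^ d) (𝓝 0) (𝓝 0) := by
    simpa [ContinuousAt, hd0] using (continuous_pow d).continuousAt (x := (0 : ℂ))
  have hrev : ∀ᶠ t in 𝓝 0, reverseMap p t ≠ 0 :=
    (analyticAt_reverseMap p 0).continuousAt.eventually_ne (by simp [reverseMap_zero hp])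
  filter_upwards [hHt.eventually hG, hGH, (hP.comp hHt).eventually hHG, hkne,
    hpow.eventually hkne, hHt.eventually hrev] with s h1 h2 h3 h4 h5 h6
  rcases eq_or_ne s 0 with rfl | hs
  · rw [zero_pow hd0, hk0, Finset.sum_eq_single d]
    · simp [hdd, hp]
    · intro j hj hjd
      have : d - j ≠ 0 := by have := Finset.mem_range.1 hj; omega
      simp [this]
    · simp
  -- Applying H to G(P(H s)) = s^d, where P t = t^d / `reverseMap p t`, gives P(H s) = H(s^d). With
  -- H s = s k(s) and s ≠ 0, the factor s^d cancels.
  · simp only [Function.comp_apply] at h3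
    rw [h1, h2, hHk, hHk s] at h3
    have h7 : k (s ^ d) * reverseMap p (s * k s) = k s ^ d := by
      rw [hHk] at h6
      have hs' := pow_ne_zero d hs
      field_simp at h3
      refine mul_left_cancel₀ hs' ?_
      linear_combination h3
    have h8 : (k (s ^ d))⁻¹ = reverseMap p (s * k s) * (k s)⁻¹ ^ d := by
      rw [inv_pow, ← h7, mul_inv]
      rw [hHk] at h6
      field_simp
    rw [h8, reverseMap, Finset.sum_mul]
    refine Finset.sum_congr rfl fun j hj => ?_
    obtain ⟨i, hi⟩ : ∃ i, p.natDegree = j + i :=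
      Nat.exists_eq_add_of_le (by have := Finset.mem_range.1 hj; omega)
    rw [hdd, hi, Nat.add_sub_cancel_left, mul_pow, pow_add, inv_pow, inv_pow]
    field_simp

/-- The inversion t = 1/z conjugates p to t^d / `reverseMap p t`, so the coordinate G at 0 and its
inverse H give 1/G(1/z) and 1/H(1/w). Writing H s = s k(s), the latter is w u(1/w) with u = 1/k, to
which the universal expansion applies. The symmetry under conjugation serves to identify ζ on the
positive axis. -/
theorem exists_boettcher_at_infty {p : ℝ[X]} (hp : p.Monic) (hd : 2 ≤ p.natDegree) :
    ∃ (g ginv : ℂ → ℂ) (R : ℝ), IsBoettcherFunction p g ∧ 0 < R ∧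
      (∀ᶠ z in cobounded ℂ, ginv (g z) = z) ∧
      (∀ w : ℂ, R < ‖w‖ → g (ginv w) = w ∧
        HasSum (fun n : ℕ => MvPolynomial.aeval (fun i : ℕ => ((p.coeff i : ℝ) : ℂ))
          ((boettcherApprox p.natDegree (n + 1)).coeff (n + 1)) / w ^ n) (ginv w - w)) ∧
      ∀ᶠ z in cobounded ℂ, g (conj z) = conj (g z) := by
  obtain ⟨G, hGa, hG0, hG1, hGP, hGc⟩ :=
    exists_boettcher_at_zero hd (analyticAt_reverseMap p 0) (reverseMap_zero hp)
  obtain ⟨H, hHa, hH0, hH1, hHG, hGH⟩ := hGa.exists_local_inverse hG0 hG1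
  obtain ⟨k, hka, hk0, hHk⟩ := hHa.exists_eq_mul hH0
  rw [hH1] at hk0
  have hfe := eventually_inverse_functional_equation hp hd hGP hHa hH0 hHG hGH hka hk0 hHk
  have hsum := hasSum_boettcherApprox (a := fun i : ℕ => ((p.coeff i : ℝ) : ℂ)) hd
    (by simp [hp]) (hka.inv (by simp [hk0])) (by simp [hk0]) hfe
  have hinv : Tendsto (fun z : ℂ => z⁻¹) (cobounded ℂ) (𝓝 0) := tendsto_inv₀_cobounded
  have hne : ∀ᶠ z in cobounded ℂ, z ≠ (0 : ℂ) := eventually_ne_cobounded 0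
  have hrad : ∀ {Q : ℂ → Prop}, (∀ᶠ t in 𝓝 0, Q t) → ∃ R : ℝ, 0 < R ∧ ∀ z : ℂ, R < ‖z‖ → Q z⁻¹ := by
    intro Q hQ
    obtain ⟨ε, hε, h⟩ := Metric.eventually_nhds_iff_ball.1 hQ
    refine ⟨ε⁻¹, inv_pos.2 hε, fun z hz => h _ ?_⟩
    rw [mem_ball_zero_iff, norm_inv]
    exact inv_lt_of_inv_lt₀ hε hz
  obtain ⟨R, hR, hRw⟩ := hrad (hGH.and hsum)
  refine ⟨fun z => (G z⁻¹)⁻¹, fun w => (H w⁻¹)⁻¹, R, ⟨?_, ?_, ?_⟩, hR, ?_, ?_, ?_⟩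
  · obtain ⟨R', hR', h⟩ := hrad (hGa.eventually_analyticAt.and hHG)
    refine ⟨R', fun z hz => ?_⟩
    have hz0 : z ≠ 0 := norm_pos_iff.1 (hR'.trans hz)
    have h2 : G z⁻¹ ≠ 0 := fun h0 => by
      have := (h z hz).2
      rw [h0, hH0] at this
      exact inv_ne_zero hz0 this.symm
    have h3 : DifferentiableAt ℂ (fun z => G z⁻¹) z :=
      DifferentiableAt.comp z (h z hz).1.differentiableAt (differentiableAt_inv hz0)
    exact (h3.inv h2).differentiableWithinAt
  · have h1 : HasDerivAt G 1 0 := hG1 ▸ hGa.differentiableAt.hasDerivAt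
    rw [hasDerivAt_iff_tendsto_slope_zero] at h1
    simp only [zero_add, hG0, sub_zero, smul_eq_mul] at h1
    have h2 := (h1.inv₀ one_ne_zero).comp (tendsto_inv₀_cobounded' (α := ℂ))
    rw [inv_one] at h2
    refine h2.congr fun z => ?_
    simp [div_eq_mul_inv, mul_comm]
  · filter_upwards [hinv.eventually hGP, hne] with z h1 h2
    rw [polyMap_eq_pow_mul_reverseMap p h2, mul_inv, ← inv_pow, inv_pow _ p.natDegree, ← h1,
      div_eq_mul_inv]
  · filter_upwards [hinv.eventually hHG] with z h1
    rw [inv_inv, h1, inv_inv]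
  · intro w hw
    have hw0 : w ≠ 0 := norm_pos_iff.1 (hR.trans hw)
    obtain ⟨h1, h2⟩ := hRw w hw
    refine ⟨by simp only [inv_inv, h1], ?_⟩
    -- The constant term u(0) = 1 contributes w itself and is split off.
    rw [hasSum_nat_add_iff' 1 |>.symm] at h2
    have h3 := h2.mul_left w
    have h4 : (H w⁻¹)⁻¹ - w = w * ((k w⁻¹)⁻¹ - 1) := by rw [hHk, mul_inv, inv_inv]; ring
    rw [h4]
    have h5 : (boettcherApprox p.natDegree 0).coeff 0 = 1 := by simp [boettcherApprox]
    simp only [Finset.range_one, Finset.sum_singleton, h5, map_one, pow_zero, mul_one] at h3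
    refine h3.congr_fun fun n => ?_
    rw [pow_succ, inv_pow]
    field_simp
  · filter_upwards [hinv.eventually (hGc (reverseMap_conj p))] with z h1
    rw [← map_inv₀, h1, map_inv₀]

/-! ### Escape to infinity and the Poincaré function -/

theorem eventually_two_mul_norm_le_norm_polyMap {p : ℝ[X]} (hp : p.Monic) (hd : 2 ≤ p.natDegree) :
    ∀ᶠ z in cobounded ℂ, 2 * ‖z‖ ≤ ‖polyMap p z‖ := by
  have h1 : ∀ᶠ t in 𝓝 (0 : ℂ), 1 / 2 < ‖reverseMap p t‖ := by
    refine continuousAt_const.eventually_lt (analyticAt_reverseMap p 0).continuousAt.norm ?_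
    rw [reverseMap_zero hp]
    norm_num
  filter_upwards [tendsto_inv₀_cobounded.eventually h1,
    tendsto_norm_cobounded_atTop.eventually_ge_atTop 4] with z h2 h3
  have hz : z ≠ 0 := norm_pos_iff.1 (by linarith)
  have h4 : ‖z‖ ^ 2 ≤ ‖z‖ ^ p.natDegree := pow_le_pow_right₀ (by linarith) hd
  rw [polyMap_eq_pow_mul_reverseMap p hz, norm_mul, norm_pow]
  calc 2 * ‖z‖ ≤ ‖z‖ ^ 2 * (1 / 2) := by nlinarith
    _ ≤ _ := by gcongr

theorem zero_notMem_basinInfty {p : ℝ[X]} (hp0 : p.eval 0 = 0) : (0 : ℂ) ∉ basinInfty p := by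
  intro h
  have h0 : polyMap p 0 = 0 := by
    rw [polyMap, ← coeff_zero_eq_aeval_zero' p, coeff_zero_eq_eval_zero, hp0, map_zero]
  have h1 : Tendsto (fun _ : ℕ => (0 : ℂ)) atTop (cobounded ℂ) := by
    refine h.congr fun n => Function.iterate_fixed h0 n
  obtain ⟨n, hn⟩ := (h1.eventually (eventually_ne_cobounded 0)).exists
  exact hn rfl

namespace IsPoincareFunction

variable {p : ℝ[X]} {f : ℂ → ℂ} {lam : ℝ}

theorem iterate (hf : IsPoincareFunction p f) (hlam : p.derivative.eval 0 = lam) (hlam0 : 0 < lam)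
    (n : ℕ) (s : ℂ) : f (Complex.exp (s + n * (Real.log lam : ℝ))) =
      (polyMap p)^[n] (f (Complex.exp s)) := by
  induction n with
  | zero => simp
  | succ n ih =>
    rw [Function.iterate_succ_apply', ← ih, ← hf.funEq, hlam]
    congr 1
    have : Complex.exp ((Real.log lam : ℝ) : ℂ) = lam := by
      rw [← Complex.ofReal_exp, Real.exp_log hlam0]
    rw [← this, ← Complex.exp_add]
    push_cast
    ring_nf

theorem exists_eq_mul (hf : IsPoincareFunction p f) :
    ∃ k : ℂ → ℂ, Tendsto k (𝓝 0) (𝓝 1) ∧ ∀ z, f z = z * k z := by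
  obtain ⟨k, hk, hk0, h⟩ := (hf.entire.analyticAt 0).exists_eq_mul hf.map_zero
  refine ⟨k, ?_, h⟩
  have := hk.continuousAt.tendsto
  rwa [hk0, hf.deriv_zero] at this

/-- If a sector lies in the basin of infinity, then so does its image under the Poincaré
function. -/
theorem exp_mem_basinInfty (hf : IsPoincareFunction p f) (hlam : p.derivative.eval 0 = lam)
    (hlam1 : 1 < lam) {α β : ℝ} (hW : sector α β ⊆ basinInfty p) {s : ℂ} (hs : s ∈ hStrip α β) :
    f (Complex.exp s) ∈ basinInfty p := by
  obtain ⟨k, hk, hfk⟩ := hf.exists_eq_mul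
  have hl : 0 < Real.log lam := Real.log_pos hlam1
  -- Translating s far to the left keeps its imaginary part and sends e^w to 0, where f(z) = z k(z)
  -- with k near 1. So w + log k(e^w), a logarithm of f(e^w), still lies in the strip. The basin
  -- hypothesis applies to f(e^w), and iterating p returns to f(e^s).
  have h1 : Tendsto (fun n : ℕ => Complex.exp (s - n * (Real.log lam : ℝ))) atTop (𝓝 0) := by
    rw [tendsto_zero_iff_norm_tendsto_zero]
    simp only [Complex.norm_exp]
    refine Real.tendsto_exp_atBot.comp ?_
    have : ∀ n : ℕ, (s - n * (Real.log lam : ℝ)).re = s.re + n * -Real.log lam := fun n => by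
      simp; ring
    simp only [this]
    exact tendsto_atBot_add_const_left _ _
      (tendsto_natCast_atTop_atTop.atTop_mul_const_of_neg (by linarith))
  have h2 : Tendsto (fun z => Complex.log (k z)) (𝓝 0) (𝓝 0) := by
    have := hk.clog (by simp)
    rwa [Complex.log_one] at this
  have h3 : Tendsto (fun z => (s + Complex.log (k z)).im) (𝓝 0) (𝓝 s.im) := by
    have := (Complex.continuous_im.tendsto _).comp (h2.const_add s)
    rwa [add_zero] at this
  have h4 : ∀ᶠ z in 𝓝 0, k z ≠ 0 := hk.eventually_ne one_ne_zero
  obtain ⟨n, h5, h6⟩ := ((h1.eventually h4).and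
    (h1.eventually (h3.eventually (Ioo_mem_nhds hs.1 hs.2)))).exists
  set w := s - n * (Real.log lam : ℝ) with hw
  have h7 : f (Complex.exp w) ∈ sector α β := by
    refine ⟨w + Complex.log (k (Complex.exp w)), ?_, ?_⟩
    · have : (w + Complex.log (k (Complex.exp w))).im =
          (s + Complex.log (k (Complex.exp w))).im := by simp [hw]
      simpa only [hStrip, Set.mem_ofPred_eq, this] using h6
    · rw [Complex.exp_add, Complex.exp_log h5, hfk]
  have h8 : s = w + n * (Real.log lam : ℝ) := by rw [hw]; ring
  rw [h8, hf.iterate hlam (by linarith)]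
  have h9 : ∀ (m : ℕ) (z : ℂ), z ∈ basinInfty p → (polyMap p)^[m] z ∈ basinInfty p := fun m z hz => by
    simp only [basinInfty, Set.mem_ofPred_eq, ← Function.iterate_add_apply] at hz ⊢
    exact (tendsto_add_atTop_iff_nat m).2 hz
  exact h9 n _ (hW h7)

/-- The Poincaré function tends to infinity, uniformly in closed subsectors. -/
theorem exists_lt_norm (hf : IsPoincareFunction p f) (hp : p.Monic) (hd : 2 ≤ p.natDegree)
    (hlam : p.derivative.eval 0 = lam) (hlam1 : 1 < lam) {α β : ℝ}
    (hW : sector α β ⊆ basinInfty p) (R : ℝ) {α' β' : ℝ} (hα : α < α') (hβ : β' < β) :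
    ∃ r : ℝ, ∀ s : ℂ, α' ≤ s.im → s.im ≤ β' → r ≤ s.re → R < ‖f (Complex.exp s)‖ := by
  set l := Real.log lam with hl'
  have hl : 0 < l := Real.log_pos hlam1
  obtain ⟨R₁, hR₁⟩ := (hasBasis_cobounded_norm.eventually_iff).1
    (eventually_two_mul_norm_le_norm_polyMap hp hd)
  obtain ⟨-, hR₁⟩ := hR₁
  set R₂ := max R R₁ with hR₂
  have hstep : ∀ z, R₂ < ‖z‖ → R₂ < ‖polyMap p z‖ := fun z hz => by
    have := hR₁ (show z ∈ {z | R₁ ≤ ‖z‖} from (le_max_right R R₁).trans hz.le)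
    linarith [norm_nonneg z]
  have hiter : ∀ n z, R₂ < ‖z‖ → R₂ < ‖(polyMap p)^[n] z‖ := fun n => by
    induction n with
    | zero => simp
    | succ n ih => intro z hz; exact ih _ (hstep z hz)
  -- These open sets increase, because p maps the exterior of the disc of radius `R₂` into itself.
  -- They cover the compact rectangle `K`, so one of them contains it. Points far to the right are
  -- translates of points of `K` by at least that many steps.
  set V : ℕ → Set ℂ := fun n => {s | R₂ < ‖f (Complex.exp (s + n * (l : ℝ)))‖} with hV
  have hVo : ∀ n, IsOpen (V n) := fun n => by
    have := hf.entire.continuous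
    exact isOpen_lt continuous_const (by fun_prop)
  have hVm : Monotone V := fun m n hmn s hs => by
    obtain ⟨j, rfl⟩ := Nat.exists_eq_add_of_le hmn
    have : s + ((m + j : ℕ) : ℂ) * (l : ℝ) = (s + m * (l : ℝ)) + j * (l : ℝ) := by
      push_cast; ring
    simp only [hV, Set.mem_ofPred_eq, this] at hs ⊢
    rw [hf.iterate hlam (by linarith)]
    exact hiter _ _ hs
  set K : Set ℂ := Set.Icc 0 l ×ℂ Set.Icc α' β' with hK
  have hKc : IsCompact K := isCompact_Icc.reProdIm isCompact_Icc
  obtain ⟨N, hN⟩ := hKc.elim_directed_cover V hVo (fun s hs => by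
    rw [hK, Complex.mem_reProdIm] at hs
    have h1 := hf.exp_mem_basinInfty hlam hlam1 hW
      (show s ∈ hStrip α β from ⟨hα.trans_le hs.2.1, hs.2.2.trans_lt hβ⟩)
    have h2 := (tendsto_norm_cobounded_atTop.comp h1).eventually_gt_atTop R₂
    obtain ⟨n, hn⟩ := h2.exists
    refine Set.mem_iUnion.2 ⟨n, ?_⟩
    simp only [hV, Set.mem_ofPred_eq]
    rw [hf.iterate hlam (by linarith)]
    exact hn) (directed_of_isDirected_le hVm)
  refine ⟨N * l, fun s h1 h2 h3 => ?_⟩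
  have hsl : (N : ℝ) ≤ s.re / l := (le_div_iff₀ hl).2 h3
  have hsl0 : 0 ≤ s.re / l := (Nat.cast_nonneg N).trans hsl
  set m := ⌊s.re / l⌋₊ with hm
  have hNm : N ≤ m := Nat.le_floor hsl
  have h4 : (m : ℝ) ≤ s.re / l := Nat.floor_le hsl0
  have h5 : s.re / l < m + 1 := Nat.lt_floor_add_one _
  rw [le_div_iff₀ hl] at h4
  rw [div_lt_iff₀ hl] at h5
  have h6 : s - m * (l : ℝ) ∈ K := by
    rw [hK, Complex.mem_reProdIm]
    refine ⟨⟨?_, ?_⟩, ⟨?_, ?_⟩⟩ <;> simp <;> linarith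
  have h7 := hVm hNm (hN h6)
  simp only [hV, Set.mem_ofPred_eq, sub_add_cancel] at h7
  exact (le_max_left _ _).trans_lt h7

/-- This is uniqueness of the normalised solution, applied to f and z ↦ conj (f (conj z)). Their
difference satisfies D(λz) = D(z)K(z) with K(0) = λ. A zero of finite order n at 0 would force λ^n =
λ, so n = 1, whereas D'(0) = 0. Hence D vanishes near 0 and so everywhere. -/
theorem conj_apply (hf : IsPoincareFunction p f) (hlam : p.derivative.eval 0 = lam)
    (hlam1 : 1 < lam) (z : ℂ) : f (conj z) = conj (f z) := by
  set f' : ℂ → ℂ := fun z => conj (f (conj z)) with hf'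
  have hfd : Differentiable ℂ f' := fun z => by
    have := (hf.entire (conj z)).conj_conj
    simpa [Function.comp_def] using this
  have hf0 : f' 0 = 0 := by simp [hf', hf.map_zero]
  have hf1 : deriv f' 0 = 1 := by
    have h := (hf.entire 0).hasDerivAt
    rw [hf.deriv_zero] at h
    have := h.conj_conj
    simpa [Function.comp_def] using this.deriv
  have hfe : ∀ z, f' (lam * z) = polyMap p (f' z) := fun z => by
    have := hf.funEq (conj z)
    rw [hlam] at this
    simp only [hf', map_mul, Complex.conj_ofReal, this, polyMap_conj]
  set D : ℂ → ℂ := fun z => f z - f' z with hD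
  have hDd : Differentiable ℂ D := hf.entire.sub hfd
  set K : ℂ → ℂ := fun z => ∑ k ∈ Finset.range (p.natDegree + 1), ((p.coeff k : ℝ) : ℂ) *
    ∑ i ∈ Finset.range k, f z ^ i * f' z ^ (k - 1 - i) with hK
  have hKc : Continuous K := by
    have h1 := hf.entire.continuous
    have h2 := hfd.continuous
    fun_prop
  have hK0 : K 0 = lam := by
    simp only [hK, hf0, hf.map_zero]
    -- At 0 only k = 1 survives, through 0^0 = 1, so K(0) is the coefficient p'(0).
    have h1 : ∀ k, ∑ i ∈ Finset.range k, (0 : ℂ) ^ i * 0 ^ (k - 1 - i) = if k = 1 then 1 else 0 := by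
      intro k
      split_ifs with hk
      · subst hk; simp
      · refine Finset.sum_eq_zero fun i hi => ?_
        have := Finset.mem_range.1 hi
        rcases eq_or_ne i 0 with rfl | hi0
        · simp [show k - 1 ≠ 0 by omega]
        · simp [hi0]
    have h2 : p.coeff 1 = lam := by
      rw [← hlam, ← coeff_zero_eq_eval_zero, coeff_derivative]
      simp
    simp only [h1, mul_ite, mul_one, mul_zero, Finset.sum_ite_eq', Finset.mem_range, h2]
    rw [if_pos]
    by_contra h3
    have : p.coeff 1 = 0 := coeff_eq_zero_of_natDegree_lt (by omega)
    rw [h2] at this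
    linarith
  have hDK : ∀ z, D (lam * z) = D z * K z := fun z => by
    have h1 := hf.funEq z
    rw [hlam] at h1
    simp only [hD, hfe, h1, polyMap_eq_sum, hK]
    rw [← Finset.sum_sub_distrib, Finset.mul_sum]
    refine Finset.sum_congr rfl fun k _ => ?_
    have := (Commute.all (f z) (f' z)).geom_sum₂_mul k
    linear_combination -((p.coeff k : ℝ) : ℂ) * this
  have hzero : ∀ᶠ z in 𝓝 0, D z = 0 := by
    by_contra hne
    obtain ⟨n, e, he, he0, hn⟩ :=
      (hDd.analyticAt 0).exists_eventuallyEq_pow_smul_nonzero_iff.2 hne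
    simp only [sub_zero, smul_eq_mul] at hn
    have hlam0 : (lam : ℂ) ≠ 0 := by exact_mod_cast (by linarith : lam ≠ 0)
    have hmul : Tendsto (fun z : ℂ => lam * z) (𝓝 0) (𝓝 0) := by
      simpa using (continuous_const_mul (lam : ℂ)).tendsto 0
    have h1 : ∀ᶠ z in 𝓝[≠] 0, lam ^ n * e (lam * z) = e z * K z := by
      filter_upwards [nhdsWithin_le_nhds hn, nhdsWithin_le_nhds (hmul.eventually hn),
        self_mem_nhdsWithin] with z h2 h3 hz
      have h4 := hDK z
      rw [h2, h3] at h4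
      refine mul_left_cancel₀ (pow_ne_zero n hz) ?_
      linear_combination h4
    have h2 : lam ^ n * e 0 = e 0 * lam := by
      have h3 : Tendsto (fun z => lam ^ n * e (lam * z)) (𝓝[≠] 0) (𝓝 (lam ^ n * e 0)) :=
        ((he.continuousAt.tendsto.comp hmul).const_mul _).mono_left nhdsWithin_le_nhds
      have h4 : Tendsto (fun z => e z * K z) (𝓝[≠] 0) (𝓝 (e 0 * lam)) := by
        rw [← hK0]
        exact (he.continuousAt.tendsto.mul hKc.continuousAt.tendsto).mono_left nhdsWithin_le_nhds
      exact tendsto_nhds_unique (h3.congr' h1) h4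
    have h3 : lam ^ n = lam := by
      have : (lam : ℂ) ^ n = lam := mul_right_cancel₀ he0 (by rw [h2, mul_comm])
      exact_mod_cast this
    have h4 : n = 1 := by
      have : lam ^ n = lam ^ 1 := by rw [h3, pow_one]
      exact pow_right_injective₀ (by linarith) (by linarith) this
    have h5 : HasDerivAt D 0 0 := by
      have := ((hf.entire 0).hasDerivAt).sub (hfd 0).hasDerivAt
      rwa [hf.deriv_zero, hf1, sub_self] at this
    have h6 : HasDerivAt D (e 0) 0 := by
      have h7 := (hasDerivAt_id (0 : ℂ)).mul he.differentiableAt.hasDerivAt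
      simp only [id, one_mul, zero_mul, add_zero] at h7
      refine h7.congr_of_eventuallyEq ?_
      filter_upwards [hn] with z hz
      simp [hz, h4]
    exact he0 (h6.unique h5)
  have hall := AnalyticOnNhd.eq_of_eventuallyEq (fun z _ => hDd.analyticAt z)
    (fun z _ => analyticAt_const) (g := fun _ => (0 : ℂ)) (z₀ := 0) hzero
  have := congrFun hall (conj z)
  simp only [hD, hf', Complex.conj_conj, sub_eq_zero] at this
  exact this

end IsPoincareFunction

/-! ### The equation h(s + l) = h(s)^d in a strip -/

theorem Convex.eq_of_hasDerivAt_zero {T : Set ℂ} (hT : Convex ℝ T) {f : ℂ → ℂ}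
    (hf : ∀ x ∈ T, HasDerivAt f 0 x) {x y : ℂ} (hx : x ∈ T) (hy : y ∈ T) : f x = f y := by
  have := hT.norm_image_sub_le_of_norm_hasDerivWithin_le (f' := fun _ => (0 : ℂ)) (C := 0)
    (fun x hx => (hf x hx).hasDerivWithinAt) (by simp) hy hx
  simpa [sub_eq_zero] using this

theorem isOpen_hStrip (a b : ℝ) : IsOpen (hStrip a b) :=
  (isOpen_lt continuous_const Complex.continuous_im).inter
    (isOpen_lt Complex.continuous_im continuous_const)

theorem convex_hStrip (a b : ℝ) : Convex ℝ (hStrip a b) :=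
  (convex_halfSpace_im_gt a).inter (convex_halfSpace_im_lt b)

/-- A nonvanishing holomorphic solution of `h (s + l) = h s ^ d` in a domain to the right in a strip
has, up to a locally constant factor, a logarithm that extends to a holomorphic solution of
`Ψ (s + l) = d * Ψ s` in the whole strip. -/
theorem exists_log_of_functional_equation {a b l : ℝ} {d : ℕ} (hd : 2 ≤ d) {Ω : Set ℂ}
    (hΩo : IsOpen Ω) (hΩs : Ω ⊆ hStrip a b) (hΩl : ∀ s ∈ Ω, s + l ∈ Ω)
    (hΩ : ∀ s ∈ hStrip a b, ∃ n : ℕ, s + n * (l : ℂ) ∈ Ω) {h : ℂ → ℂ}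
    (hh : DifferentiableOn ℂ h Ω) (hh0 : ∀ s ∈ Ω, h s ≠ 0)
    (hfe : ∀ s ∈ Ω, h (s + l) = h s ^ d) :
    ∃ Ψ : ℂ → ℂ, DifferentiableOn ℂ Ψ (hStrip a b) ∧ (∀ s, Ψ (s + l) = d * Ψ s) ∧
      ∀ s ∈ Ω, HasDerivAt (fun s => h s * Complex.exp (-Ψ s)) 0 s := by
  classical
  have hd0 : (d : ℂ) ≠ 0 := by exact_mod_cast (by omega : d ≠ 0)
  have hd1 : (d : ℂ) - 1 ≠ 0 := by
    rw [sub_ne_zero]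
    exact_mod_cast (by omega : d ≠ 1)
  have hSl : ∀ s, s + (l : ℂ) ∈ hStrip a b ↔ s ∈ hStrip a b := fun s => by simp [hStrip]
  -- The logarithmic derivative needs no branch on Ω, which need not be simply connected. It
  -- satisfies v(s + l) = d v(s), so v(s + nl)/d^n does not depend on n and extends v to the whole
  -- strip. The strip is convex, so the extension has a primitive there.
  set v : ℂ → ℂ := logDeriv h with hv
  have hhd : ∀ s ∈ Ω, HasDerivAt h (deriv h s) s := fun s hs =>
    (hh.differentiableAt (hΩo.mem_nhds hs)).hasDerivAt
  have hvd : DifferentiableOn ℂ v Ω := (hh.deriv hΩo).div hh hh0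
  have hvl : ∀ s ∈ Ω, v (s + l) = d * v s := fun s hs => by
    have h1 : HasDerivAt (fun s => h (s + l)) (deriv h (s + l)) s :=
      (hhd _ (hΩl s hs)).comp_add_const s l
    have h2 : HasDerivAt (fun s => h (s + l)) (d * h s ^ (d - 1) * deriv h s) s := by
      refine ((hhd s hs).pow d).congr_of_eventuallyEq ?_
      filter_upwards [hΩo.mem_nhds hs] with t ht using hfe t ht
    have h3 := h1.unique h2
    have h4 := hh0 s hs
    obtain ⟨e, rfl⟩ : ∃ e, d = e + 1 := ⟨d - 1, by omega⟩
    simp only [hv, logDeriv_apply, h3, hfe s hs, Nat.add_sub_cancel]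
    rw [pow_succ]
    field_simp
  have hΩn : ∀ (n : ℕ), ∀ s ∈ Ω, s + n * (l : ℂ) ∈ Ω := fun n => by
    induction n with
    | zero => simp
    | succ n ih =>
      intro s hs
      have := hΩl _ (ih s hs)
      convert this using 1
      push_cast; ring
  have hvn : ∀ (n : ℕ), ∀ s ∈ Ω, v (s + n * (l : ℂ)) = d ^ n * v s := fun n => by
    induction n with
    | zero => simp
    | succ n ih =>
      intro s hs
      have := hvl _ (hΩn n s hs)
      rw [ih s hs] at this
      have e : s + ((n + 1 : ℕ) : ℂ) * l = s + n * l + l := by push_cast; ring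
      rw [e, this]; ring
  have hind : ∀ (m n : ℕ) (s : ℂ), s + m * (l : ℂ) ∈ Ω → s + n * (l : ℂ) ∈ Ω →
      v (s + m * (l : ℂ)) / d ^ m = v (s + n * (l : ℂ)) / d ^ n := by
    have key : ∀ (m j : ℕ) (s : ℂ), s + m * (l : ℂ) ∈ Ω →
        v (s + m * (l : ℂ)) / d ^ m = v (s + (m + j : ℕ) * (l : ℂ)) / d ^ (m + j) := by
      intro m j s hm
      have e : s + ((m + j : ℕ) : ℂ) * l = s + m * l + j * l := by push_cast; ring
      rw [e, hvn j _ hm, pow_add]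
      field_simp
    intro m n s hm hn
    rcases le_total m n with hmn | hmn
    · obtain ⟨j, rfl⟩ := Nat.exists_eq_add_of_le hmn
      exact key m j s hm
    · obtain ⟨j, rfl⟩ := Nat.exists_eq_add_of_le hmn
      exact (key n j s hn).symm
  choose! N hN using hΩ
  set V : ℂ → ℂ := fun s => v (s + N s * (l : ℂ)) / d ^ N s with hV
  have hVn : ∀ s (n : ℕ), s ∈ hStrip a b → s + n * (l : ℂ) ∈ Ω →
      V s = v (s + n * (l : ℂ)) / d ^ n := fun s n hs hn => hind _ _ s (hN s hs) hn
  have hVΩ : ∀ s ∈ Ω, V s = v s := fun s hs => by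
    simpa using hVn s 0 (hΩs hs) (by simpa using hs)
  have hVl : ∀ s ∈ hStrip a b, V (s + l) = d * V s := fun s hs => by
    have h1 := hΩl _ (hN s hs)
    have h2 : s + l + N s * (l : ℂ) = s + N s * (l : ℂ) + l := by ring
    rw [hVn (s + l) (N s) ((hSl s).2 hs) (h2 ▸ h1), h2, hvl _ (hN s hs), mul_div_assoc]
  have hVd : DifferentiableOn ℂ V (hStrip a b) := fun s hs => by
    have h1 : DifferentiableAt ℂ (fun t => v (t + N s * (l : ℂ)) / d ^ N s) s := by
      have h2 := hvd.differentiableAt (hΩo.mem_nhds (hN s hs))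
      exact (h2.comp s (differentiableAt_id.add_const _)).div_const _
    refine (h1.congr_of_eventuallyEq ?_).differentiableWithinAt
    have h3 : ContinuousAt (fun t => t + N s * (l : ℂ)) s := by fun_prop
    filter_upwards [(isOpen_hStrip a b).mem_nhds hs,
      h3.preimage_mem_nhds (hΩo.mem_nhds (hN s hs))] with t ht1 ht2
    exact hVn t (N s) ht1 ht2
  obtain ⟨W, hW⟩ := (convex_hStrip a b).exists_forall_hasDerivWithinAt hVd
  have hW' : ∀ s ∈ hStrip a b, HasDerivAt W (V s) s := fun s hs =>
    (hW s hs).hasDerivAt ((isOpen_hStrip a b).mem_nhds hs)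
  obtain ⟨K, hK⟩ : ∃ K, ∀ s ∈ hStrip a b, W (s + l) - d * W s = K := by
    rcases (hStrip a b).eq_empty_or_nonempty with he | ⟨s₀, hs₀⟩
    · exact ⟨0, by simp [he]⟩
    · refine ⟨W (s₀ + l) - d * W s₀, fun s hs =>
        (convex_hStrip a b).eq_of_hasDerivAt_zero (f := fun s => W (s + l) - d * W s)
        (fun x hx => ?_) hs hs₀⟩
      have h1 := ((hW' _ ((hSl x).2 hx)).comp_add_const x (l : ℂ)).sub ((hW' x hx).const_mul (d : ℂ))
      rwa [hVl x hx, sub_self] at h1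
  -- Adding K/(d - 1) removes the constant K from W(s + l) - dW(s) = K. The value 0 off the strip,
  -- which is invariant under translation by l, makes the equation hold for every s.
  refine ⟨fun s => if s ∈ hStrip a b then W s + K / (d - 1) else 0, ?_, ?_, ?_⟩
  · refine DifferentiableOn.congr (f := fun s => W s + K / (d - 1)) (fun s hs =>
      ((hW s hs).differentiableWithinAt.add_const _)) fun s hs => by simp [hs]
  · intro s
    simp only [hSl]
    split_ifs with hs
    · have := hK s hs
      field_simp
      linear_combination ((d : ℂ) - 1) * this
    · simp
  · intro s hs
    have h1 : HasDerivAt (fun s => if s ∈ hStrip a b then W s + K / (d - 1) else 0) (v s) s := by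
      rw [← hVΩ s hs]
      refine ((hW' s (hΩs hs)).add_const (K / (d - 1))).congr_of_eventuallyEq ?_
      filter_upwards [(isOpen_hStrip a b).mem_nhds (hΩs hs)] with t ht
      simp [ht]
    have h2 := (hhd s hs).mul h1.neg.cexp
    have h3 : deriv h s = v s * h s := by
      rw [hv, logDeriv_apply, div_mul_cancel₀ _ (hh0 s hs)]
    have h4 : ∀ x : ℂ, deriv h s * x + h s * (x * -v s) = 0 := fun x => by rw [h3]; ring
    rw [h4] at h2
    exact h2

/-- A holomorphic solution of `h (s + l) = h s ^ d` with `1 < ‖h‖`, given far to the right in a strip,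
is `ζ * exp Ψ` there, with `Ψ (s + l) = d * Ψ s` in the whole strip and `ζ ^ (d - 1) = 1`. -/
theorem exists_const_mul_exp {a b l : ℝ} (hab : a < b) (hl : 0 < l) {d : ℕ} (hd : 2 ≤ d)
    {Ω : Set ℂ} (hΩo : IsOpen Ω) (hΩs : Ω ⊆ hStrip a b) (hΩl : ∀ s ∈ Ω, s + l ∈ Ω)
    (hΩ : ∀ a' b' : ℝ, a < a' → b' < b →
      ∃ r : ℝ, ∀ s : ℂ, a' ≤ s.im → s.im ≤ b' → r ≤ s.re → s ∈ Ω)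
    {h : ℂ → ℂ} (hh : DifferentiableOn ℂ h Ω) (hh0 : ∀ s ∈ Ω, 1 < ‖h s‖)
    (hfe : ∀ s ∈ Ω, h (s + l) = h s ^ d) :
    ∃ (ζ : ℂ) (Ψ : ℂ → ℂ), ζ ^ (d - 1) = 1 ∧ DifferentiableOn ℂ Ψ (hStrip a b) ∧
      (∀ s, Ψ (s + l) = d * Ψ s) ∧ (∀ s ∈ hStrip a b, 0 < (Ψ s).re) ∧
      (∀ m : ℝ, a < m → m < b → (∃ r : ℝ, ∀ x : ℝ, r ≤ x →
        ∃ y : ℝ, 0 < y ∧ h (x + m * Complex.I) = y) → ζ = 1) ∧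
      ∀ a' b' : ℝ, a < a' → b' < b → ∃ r : ℝ, ∀ s : ℂ, a' ≤ s.im → s.im ≤ b' → r ≤ s.re →
        s ∈ Ω ∧ h s = ζ * Complex.exp (Ψ s) := by
  have hne : ∀ s ∈ Ω, h s ≠ 0 := fun s hs => norm_pos_iff.1 (one_pos.trans (hh0 s hs))
  have hΩ' : ∀ s ∈ hStrip a b, ∃ n : ℕ, s + n * (l : ℂ) ∈ Ω := fun s hs => by
    obtain ⟨r, hr⟩ := hΩ s.im s.im hs.1 hs.2
    obtain ⟨n, hn⟩ := exists_nat_ge ((r - s.re) / l)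
    rw [div_le_iff₀ hl] at hn
    exact ⟨n, hr _ (by simp) (by simp) (by simp; linarith)⟩
  obtain ⟨Ψ, hΨd, hΨl, hΨ⟩ :=
    exists_log_of_functional_equation hd hΩo hΩs hΩl hΩ' hh hne hfe
  set c : ℝ := (a + b) / 2 with hc
  obtain ⟨r₀, hr₀⟩ := hΩ c c (by linarith) (by linarith)
  set s₀ : ℂ := ⟨r₀, c⟩ with hs₀
  set ζ : ℂ := h s₀ * Complex.exp (-Ψ s₀) with hζ
  have hconst : ∀ a' b' : ℝ, a < a' → b' < b → ∃ r : ℝ, ∀ s : ℂ, a' ≤ s.im → s.im ≤ b' →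
      r ≤ s.re → s ∈ Ω ∧ h s = ζ * Complex.exp (Ψ s) := by
    intro a' b' ha' hb'
    obtain ⟨r, hr⟩ := hΩ (min a' c) (max b' c) (lt_min ha' (by linarith)) (max_lt hb' (by linarith))
    refine ⟨r, fun s h1 h2 h3 => ?_⟩
    have hsΩ := hr s ((min_le_left _ _).trans h1) (h2.trans (le_max_left _ _)) h3
    refine ⟨hsΩ, ?_⟩
    -- The factor is only locally constant on Ω. It is carried from s to `s₁` inside a half-strip
    -- and from `s₁` to `s₀` along the middle line, so the same ζ serves for all closed substrips.
    set s₁ : ℂ := ⟨max r r₀, c⟩ with hs₁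
    have hconv : ∀ x₁ x₂ y : ℝ, Convex ℝ {z : ℂ | x₁ ≤ z.im ∧ z.im ≤ x₂ ∧ y ≤ z.re} :=
      fun x₁ x₂ y => (convex_halfSpace_im_ge x₁).inter
        ((convex_halfSpace_im_le x₂).inter (convex_halfSpace_re_ge y))
    have e1 := (hconv (min a' c) (max b' c) r).eq_of_hasDerivAt_zero (x := s) (y := s₁)
      (fun x hx => hΨ x (hr x hx.1 hx.2.1 hx.2.2))
      ⟨(min_le_left _ _).trans h1, h2.trans (le_max_left _ _), h3⟩
      ⟨min_le_right _ _, le_max_right _ _, le_max_left _ _⟩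
    have e2 := (hconv c c r₀).eq_of_hasDerivAt_zero (x := s₁) (y := s₀)
      (fun x hx => hΨ x (hr₀ x hx.1 hx.2.1 hx.2.2))
      ⟨le_rfl, le_rfl, le_max_right _ _⟩ ⟨le_rfl, le_rfl, le_rfl⟩
    rw [hζ, ← e2, ← e1, mul_assoc, ← Complex.exp_add, neg_add_cancel, Complex.exp_zero, mul_one]
  have hζ0 : ζ ≠ 0 := mul_ne_zero (hne _ (hr₀ _ le_rfl le_rfl le_rfl)) (Complex.exp_ne_zero _)
  have hζd : ζ ^ (d - 1) = 1 := by
    obtain ⟨r, hr⟩ := hconst c c (by linarith) (by linarith)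
    obtain ⟨h1, h2⟩ := hr ⟨r, c⟩ le_rfl le_rfl le_rfl
    obtain ⟨-, h3⟩ := hr (⟨r, c⟩ + l) (by simp) (by simp) (by simp; linarith)
    rw [hfe _ h1, h2, hΨl, mul_pow, ← Complex.exp_nat_mul] at h3
    have h4 := mul_right_cancel₀ (Complex.exp_ne_zero _) h3
    obtain ⟨e, rfl⟩ : ∃ e, d = e + 1 := ⟨d - 1, by omega⟩
    rw [pow_succ] at h4
    exact mul_right_cancel₀ hζ0 (by simpa using h4)
  have hζn : ‖ζ‖ = 1 := Complex.norm_eq_one_of_pow_eq_one hζd (by omega)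
  have hΨn : ∀ (n : ℕ) (s : ℂ), Ψ (s + n * (l : ℂ)) = d ^ n * Ψ s := fun n => by
    induction n with
    | zero => simp
    | succ n ih =>
      intro s
      have e : s + ((n + 1 : ℕ) : ℂ) * l = s + n * l + l := by push_cast; ring
      rw [e, hΨl, ih]; ring
  refine ⟨ζ, Ψ, hζd, hΨd, hΨl, fun s hs => ?_, fun m hma hmb => ?_, hconst⟩
  -- After enough translations |h| > 1 and |ζ| = 1 give Re(d^n Ψ(s)) > 0, and the positive factor
  -- d^n is dropped.
  · obtain ⟨r, hr⟩ := hconst s.im s.im hs.1 hs.2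
    obtain ⟨n, hn⟩ := exists_nat_ge ((r - s.re) / l)
    rw [div_le_iff₀ hl] at hn
    obtain ⟨h1, h2⟩ := hr (s + n * (l : ℂ)) (by simp) (by simp) (by simp; linarith)
    have h3 := hh0 _ h1
    rw [h2, norm_mul, hζn, one_mul, Complex.norm_exp, Real.one_lt_exp_iff, hΨn] at h3
    have h4 : ((d : ℂ) ^ n * Ψ s).re = (d : ℝ) ^ n * (Ψ s).re := by
      rw [← Complex.re_ofReal_mul]; push_cast; rfl
    rw [h4] at h3
    exact pos_of_mul_pos_right h3 (by positivity)
  · rintro ⟨r₁, hr₁⟩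
    obtain ⟨r₂, hr₂⟩ := hconst m m hma hmb
    set r := max r₁ r₂ with hrdef
    have hline : ∀ x : ℝ, ((x : ℂ) + m * Complex.I) ∈ hStrip a b := fun x => by
      simp [hStrip, hma, hmb]
    -- Positivity of h cancels the modulus, leaving ζe^(iy) = 1 with y = Im Ψ. Differentiating shows
    -- that y is constant on x > r, while y(x + l) = d y(x); hence y = 0.
    have key : ∀ x : ℝ, r ≤ x →
        ζ * Complex.exp (((Ψ (x + m * Complex.I)).im : ℂ) * Complex.I) = 1 := fun x hx => by
      obtain ⟨y, hy, h1⟩ := hr₁ x ((le_max_left _ _).trans hx)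
      obtain ⟨-, h2⟩ := hr₂ (x + m * Complex.I) (by simp) (by simp)
        (by simpa using (le_max_right _ _).trans hx)
      have h3 : y = Real.exp (Ψ (x + m * Complex.I)).re := by
        have := congrArg norm h2
        rwa [h1, norm_mul, hζn, one_mul, Complex.norm_exp, Complex.norm_real, Real.norm_of_nonneg
          hy.le] at this
      have h4 : Complex.exp (Ψ (x + m * Complex.I)) = Complex.exp ((Ψ (x + m * Complex.I)).re : ℂ) *
          Complex.exp (((Ψ (x + m * Complex.I)).im : ℂ) * Complex.I) := by
        rw [← Complex.exp_add, Complex.re_add_im]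
      rw [h1, h4, h3, Complex.ofReal_exp] at h2
      refine mul_left_cancel₀ (Complex.exp_ne_zero ((Ψ (x + m * Complex.I)).re : ℂ)) ?_
      linear_combination -h2
    set y : ℝ → ℝ := fun x => (Ψ (x + m * Complex.I)).im with hy
    have hyd : ∀ x : ℝ, HasDerivAt y (deriv Ψ (x + m * Complex.I)).im x := fun x => by
      have h1 := (hΨd.differentiableAt ((isOpen_hStrip a b).mem_nhds (hline x))).hasDerivAt
      have h2 : HasDerivAt (fun x : ℝ => (x : ℂ) + m * Complex.I) 1 x :=
        Complex.ofRealCLM.hasDerivAt.add_const _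
      have h3 := h1.comp x h2
      rw [mul_one] at h3
      exact Complex.imCLM.hasFDerivAt.comp_hasDerivAt x h3
    have hyd0 : ∀ x, r < x → HasDerivAt y 0 x := fun x hx => by
      have h1 := ((hyd x).ofReal_comp.mul_const Complex.I).cexp.const_mul ζ
      have h2 : HasDerivAt (fun x : ℝ => ζ * Complex.exp ((y x : ℂ) * Complex.I)) 0 x := by
        refine (hasDerivAt_const x (1 : ℂ)).congr_of_eventuallyEq ?_
        filter_upwards [lt_mem_nhds hx] with t ht using key t ht.le
      have h3 := h1.unique h2
      have h4 : (deriv Ψ (x + m * Complex.I)).im = 0 := by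
        simpa [hζ0, Complex.exp_ne_zero] using h3
      exact h4 ▸ hyd x
    have h1 : y (r + 1 + l) = y (r + 1) := by
      have := (convex_Ioi r).norm_image_sub_le_of_norm_hasDerivWithin_le (f := y)
        (f' := fun _ => (0 : ℝ)) (C := 0) (fun x hx => (hyd0 x hx).hasDerivWithinAt) (by simp)
        (show r + 1 ∈ Set.Ioi r from lt_add_one r)
        (show r + 1 + l ∈ Set.Ioi r by rw [Set.mem_Ioi]; linarith)
      simpa [sub_eq_zero] using this
    have h2 : y (r + 1 + l) = d * y (r + 1) := by
      have e : (((r + 1 + l : ℝ) : ℂ) + m * Complex.I) = ((r + 1 : ℝ) : ℂ) + m * Complex.I + l := by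
        push_cast; ring
      simp only [hy]
      rw [e, hΨl, ← Complex.im_ofReal_mul]
      push_cast
      rfl
    have h3 : y (r + 1) = 0 := by
      have hdr : (2 : ℝ) ≤ d := by exact_mod_cast hd
      have : ((d : ℝ) - 1) * y (r + 1) = 0 := by linear_combination h1 - h2
      rcases mul_eq_zero.1 this with h | h
      · linarith
      · exact h
    have h4 := key (r + 1) (by linarith)
    have h5 : (Ψ (((r + 1 : ℝ) : ℂ) + m * Complex.I)).im = 0 := h3
    rwa [h5, Complex.ofReal_zero, zero_mul, Complex.exp_zero, mul_one] at h4

/-! ### Positivity on the real axis and the main theorem -/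

theorem two_le_natDegree {p : ℝ[X]} (hp : p.Monic) {lam : ℝ} (hlam : p.derivative.eval 0 = lam)
    (hlam1 : 1 < lam) : 2 ≤ p.natDegree := by
  have h1 : p.coeff 1 = lam := by
    rw [← hlam, ← coeff_zero_eq_eval_zero, coeff_derivative]
    simp
  by_contra! h
  rcases (by omega : p.natDegree = 0 ∨ p.natDegree = 1) with h0 | h0
  · have : p.coeff 1 = 0 := coeff_eq_zero_of_natDegree_lt (by omega)
    linarith
  · have : p.coeff 1 = 1 := by rw [← h0]; exact hp
    linarith

/-- If a sector around the positive real axis lies in the basin of infinity, then the Poincaré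
function is positive on the positive real axis. -/
theorem IsPoincareFunction.exists_pos_of_exp {p : ℝ[X]} {f : ℂ → ℂ} {lam : ℝ}
    (hf : IsPoincareFunction p f) (hp0 : p.eval 0 = 0) (hlam : p.derivative.eval 0 = lam)
    (hlam1 : 1 < lam) {α β m : ℝ} (hW : sector α β ⊆ basinInfty p) (hα : α < m) (hβ : m < β)
    (hm : Complex.exp (m * Complex.I) = 1) (x : ℝ) :
    ∃ y : ℝ, 0 < y ∧ f (Complex.exp (x + m * Complex.I)) = y := by
  have hexp : ∀ x : ℝ, Complex.exp (x + m * Complex.I) = (Real.exp x : ℝ) := fun x => by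
    rw [Complex.exp_add, hm, mul_one, Complex.ofReal_exp]
  have hreal : ∀ t : ℝ, f t = ((f t).re : ℂ) := fun t => by
    refine (Complex.conj_eq_iff_re.1 ?_).symm
    rw [← hf.conj_apply hlam hlam1, Complex.conj_ofReal]
  -- On the positive axis f is real by conjugation symmetry, has no zero because its values lie in
  -- the basin while 0 is fixed, and is positive near 0 because f(z)/z → 1. The intermediate value
  -- theorem concludes.
  have hne : ∀ x : ℝ, (f (Real.exp x : ℝ)).re ≠ 0 := fun x h0 => by
    have h1 : f (Real.exp x : ℝ) = 0 := by rw [hreal, h0, Complex.ofReal_zero]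
    have h2 := hf.exp_mem_basinInfty hlam hlam1 hW
      (show (x + m * Complex.I : ℂ) ∈ hStrip α β by simp [hStrip, hα, hβ])
    rw [hexp, h1] at h2
    exact zero_notMem_basinInfty hp0 h2
  obtain ⟨k, hk, hfk⟩ := hf.exists_eq_mul
  have hsmall : ∀ᶠ x : ℝ in atBot, 0 < (f (Real.exp x : ℝ)).re := by
    have h1 : Tendsto (fun x : ℝ => ((Real.exp x : ℝ) : ℂ)) atBot (𝓝 0) := by
      have := (Complex.continuous_ofReal.tendsto 0).comp Real.tendsto_exp_atBot
      rwa [Complex.ofReal_zero] at this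
    have h2 := (Complex.continuous_re.tendsto _).comp (hk.comp h1)
    filter_upwards [h2.eventually (lt_mem_nhds (show (0 : ℝ) < (1 : ℂ).re by simp))] with x hx
    rw [hfk, Complex.re_ofReal_mul]
    exact mul_pos (Real.exp_pos x) hx
  refine ⟨(f (Real.exp x : ℝ)).re, ?_, by rw [hexp, ← hreal]⟩
  obtain ⟨x₀, hx₀⟩ := hsmall.exists
  by_contra! hx
  have hc : Continuous fun x : ℝ => (f (Real.exp x : ℝ)).re := by
    have := hf.entire.continuous
    fun_prop
  obtain ⟨x₁, hx₁⟩ := mem_range_of_exists_le_of_exists_ge hc ⟨x, hx⟩ ⟨x₀, hx₀.le⟩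
  exact hne x₁ hx₁

theorem mainTheorem2 :
    -- `C d n`: universal polynomials giving the `n`-th coefficient from the coefficients of `p`
    ∃ C : ℕ → ℕ → MvPolynomial ℕ ℚ,
    ∀ (p : ℝ[X]), p.Monic → p.eval 0 = 0 → ∀ (lam : ℝ), p.derivative.eval 0 = lam → 1 < lam →
    ∃ (c : ℕ → ℂ) (g ginv : ℂ → ℂ) (R : ℝ),
      (∀ n, c n = MvPolynomial.aeval (fun i : ℕ => ((p.coeff i : ℝ) : ℂ)) (C p.natDegree n)) ∧
      IsBoettcherFunction p g ∧
      -- `ginv` is the inverse of `g` near `∞`, with its Laurent series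
      0 < R ∧
      (∀ᶠ z in Bornology.cobounded ℂ, ginv (g z) = z) ∧
      (∀ w : ℂ, R < ‖w‖ → g (ginv w) = w ∧ HasSum (fun n : ℕ => c n / w ^ n) (ginv w - w)) ∧
      ∀ (f : ℂ → ℂ), IsPoincareFunction p f →
      ∀ (α β : ℝ), α < β → β ≤ α + 2 * Real.pi → sector α β ⊆ basinInfty p →
      ∃ (ζ : ℂ) (F : ℂ → ℂ),
        ζ ^ (p.natDegree - 1) = 1 ∧
        ((∃ x : ℝ, 0 < x ∧ (x : ℂ) ∈ sector α β) → ζ = 1) ∧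
        Function.Periodic F 1 ∧
        DifferentiableOn ℂ F (hStrip (α / Real.log lam) (β / Real.log lam)) ∧
        -- below `z = exp s`, `log z = s` and `z ^ ρ = exp (ρ * s)`
        (∀ s ∈ hStrip α β,
          0 < (Complex.exp (((Real.logb lam p.natDegree : ℝ) : ℂ) * s)
            * F (s / ((Real.log lam : ℝ) : ℂ))).re) ∧
        ∀ α' β' : ℝ, α < α' → β' < β → ∃ r : ℝ, ∀ s : ℂ, α' ≤ s.im → s.im ≤ β' →
          r < ‖Complex.exp s‖ →
          ∀ E : ℂ, E = Complex.exp (((Real.logb lam p.natDegree : ℝ) : ℂ) * s)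
              * F (s / ((Real.log lam : ℝ) : ℂ)) →
          HasSum (fun n : ℕ => c n * (ζ ^ n)⁻¹ * Complex.exp (-(n : ℂ) * E))
            (f (Complex.exp s) - ζ * Complex.exp E) ∧
          R < ‖ζ * Complex.exp E‖ ∧
          f (Complex.exp s) = ginv (ζ * Complex.exp E) := by
  -- The index is shifted by one because the inverse is w u(1/w): c_n is the coefficient of t^(n+1)
  -- in u.
  refine ⟨fun d n => (boettcherApprox d (n + 1)).coeff (n + 1), fun p hp hp0 lam hlam hlam1 => ?_⟩
  have hd := two_le_natDegree hp hlam hlam1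
  obtain ⟨g, ginv, R, hg, hR, hinv, hinv', hgc⟩ := exists_boettcher_at_infty hp hd
  refine ⟨_, g, ginv, R, fun n => rfl, hg, hR, hinv, hinv', fun f hf α β hαβ _ hW => ?_⟩
  set d := p.natDegree with hdd
  set l := Real.log lam with hl'
  have hlam0 : 0 < lam := by linarith
  have hl : 0 < l := Real.log_pos hlam1
  have hl0 : (l : ℂ) ≠ 0 := by exact_mod_cast hl.ne'
  obtain ⟨R₁, hgd⟩ := hg.holomorphic
  have hgd' : ∀ᶠ z in cobounded ℂ, DifferentiableAt ℂ g z := by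
    filter_upwards [tendsto_norm_cobounded_atTop.eventually_gt_atTop R₁] with z hz
    exact hgd.differentiableAt ((isOpen_lt continuous_const continuous_norm).mem_nhds hz)
  have hgre : ∀ᶠ z in cobounded ℂ, 0 < (g z / z).re :=
    ((Complex.continuous_re.tendsto _).comp hg.tangent).eventually
      (lt_mem_nhds (show (0 : ℝ) < (1 : ℂ).re by simp))
  have hgn : ∀ᶠ z in cobounded ℂ, max 1 R < ‖g z‖ := by
    have h1 := hg.tangent.norm.eventually (lt_mem_nhds (show (1 / 2 : ℝ) < ‖(1 : ℂ)‖ by norm_num))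
    filter_upwards [h1, tendsto_norm_cobounded_atTop.eventually_gt_atTop (2 * max 1 R)] with z h2 h3
    have hz : 0 < ‖z‖ := lt_trans (by positivity) h3
    rw [norm_div, lt_div_iff₀ hz] at h2
    linarith
  obtain ⟨R₂, -, hR₂⟩ := (hasBasis_cobounded_norm.eventually_iff).1
    (hgd'.and (hgre.and (hgn.and (hinv.and (hgc.and (hg.funEq.and
      (eventually_two_mul_norm_le_norm_polyMap hp hd)))))))
  have hfc := hf.entire.continuous
  -- Here f(e^s) lies beyond the radius `R₂` from which all the local properties of g hold, and
  -- doubling of norms under p makes the set invariant under s ↦ s + l.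
  set Ω : Set ℂ := hStrip α β ∩ {s | max 0 R₂ < ‖f (Complex.exp s)‖} with hΩ
  have hΩR : ∀ s ∈ Ω, f (Complex.exp s) ∈ {z : ℂ | R₂ ≤ ‖z‖} := fun s hs =>
    (le_max_right 0 R₂).trans (le_of_lt hs.2)
  have hφl : ∀ s, f (Complex.exp (s + l)) = polyMap p (f (Complex.exp s)) := fun s => by
    simpa using hf.iterate hlam hlam0 1 s
  have hΩo : IsOpen Ω :=
    (isOpen_hStrip α β).inter (isOpen_lt continuous_const (by fun_prop))
  have hΩl : ∀ s ∈ Ω, s + l ∈ Ω := fun s hs => by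
    refine ⟨by simpa [hStrip] using hs.1, ?_⟩
    have h1 := (hR₂ (hΩR s hs)).2.2.2.2.2.2
    have h2 : max 0 R₂ < ‖f (Complex.exp s)‖ := hs.2
    rw [Set.mem_ofPred_eq, hφl]
    linarith [norm_nonneg (f (Complex.exp s))]
  have hΩe : ∀ a' b' : ℝ, α < a' → b' < β →
      ∃ r : ℝ, ∀ s : ℂ, a' ≤ s.im → s.im ≤ b' → r ≤ s.re → s ∈ Ω := fun a' b' ha' hb' => by
    obtain ⟨r, hr⟩ := hf.exists_lt_norm hp hd hlam hlam1 hW (max 0 R₂) ha' hb'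
    exact ⟨r, fun s h1 h2 h3 => ⟨⟨ha'.trans_le h1, h2.trans_lt hb'⟩, hr s h1 h2 h3⟩⟩
  obtain ⟨ζ, Ψ, hζ, hΨd, hΨl, hΨre, hζ1, hconst⟩ := exists_const_mul_exp hαβ hl hd hΩo
    Set.inter_subset_left hΩl hΩe (h := fun s => g (f (Complex.exp s)))
    (fun s hs => by
      have h1 := (hR₂ (hΩR s hs)).1
      have h2 : DifferentiableAt ℂ (fun s => f (Complex.exp s)) s :=
        (hf.entire _).comp s Complex.differentiable_exp.differentiableAt
      exact (DifferentiableAt.comp s h1 h2).differentiableWithinAt)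
    (fun s hs => (le_max_left 1 R).trans_lt (hR₂ (hΩR s hs)).2.2.1)
    (fun s hs => by rw [hφl]; exact (hR₂ (hΩR s hs)).2.2.2.2.2.1.symm)
  set ρ : ℂ := ((Real.logb lam d : ℝ) : ℂ) with hρ
  have hρl : Complex.exp (ρ * l) = d := by
    have h1 : Real.logb lam d * l = Real.log d := by
      rw [Real.logb, div_mul_cancel₀ _ hl.ne']
    have hd0 : (0 : ℝ) < d := by exact_mod_cast (by omega : 0 < d)
    rw [hρ, ← Complex.ofReal_mul, h1, ← Complex.ofReal_exp, Real.exp_log hd0, Complex.ofReal_natCast]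
  -- Both e^(ρs) and Ψ(s) are multiplied by d under s ↦ s + l, so their quotient at s = ul has
  -- period 1 in u.
  set F : ℂ → ℂ := fun u => Complex.exp (-(ρ * (u * l))) * Ψ (u * l) with hF
  have hE : ∀ s, Complex.exp (ρ * s) * F (s / l) = Ψ s := fun s => by
    simp only [hF]
    rw [div_mul_cancel₀ _ hl0, ← mul_assoc, ← Complex.exp_add, add_neg_cancel, Complex.exp_zero,
      one_mul]
  refine ⟨ζ, F, hζ, ?_, ?_, ?_, ?_, ?_⟩
  · rintro ⟨x₀, hx₀, s₀, hs₀, hx⟩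
    refine hζ1 s₀.im hs₀.1 hs₀.2 ?_
    have hm : Complex.exp (s₀.im * Complex.I) = 1 := by
      have h1 : Complex.exp s₀ = Complex.exp (s₀.re : ℂ) * Complex.exp (s₀.im * Complex.I) := by
        rw [← Complex.exp_add, Complex.re_add_im]
      have h2 : x₀ = Real.exp s₀.re := by
        have := congrArg norm hx
        rwa [Complex.norm_exp, Complex.norm_real, Real.norm_of_nonneg hx₀.le, eq_comm] at this
      rw [hx, h2, Complex.ofReal_exp] at h1
      exact (mul_left_cancel₀ (Complex.exp_ne_zero _) (by rw [mul_one]; exact h1)).symm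
    obtain ⟨r, hr⟩ := hΩe s₀.im s₀.im hs₀.1 hs₀.2
    refine ⟨r, fun x hx => ?_⟩
    have h1 := hR₂ (hΩR _ (hr (x + s₀.im * Complex.I) (by simp) (by simp) (by simpa using hx)))
    obtain ⟨y, hy, hxy⟩ := hf.exists_pos_of_exp hp0 hlam hlam1 hW hs₀.1 hs₀.2 hm x
    rw [hxy] at h1 ⊢
    -- Conjugation symmetry makes g(y) real, and Re(g(y)/y) > 0 makes it positive.
    have h2 := h1.2.2.2.2.1
    rw [Complex.conj_ofReal] at h2
    have h3 := Complex.conj_eq_iff_re.1 h2.symm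
    refine ⟨(g y).re, ?_, h3.symm⟩
    have h4 := h1.2.1
    rw [Complex.div_ofReal_re] at h4
    exact (div_pos_iff_of_pos_right hy).1 h4
  · intro u
    have e1 : (u + 1) * (l : ℂ) = u * l + l := by ring
    have e2 : -(ρ * (u * l + l)) = -(ρ * (u * l)) - ρ * l := by ring
    have hd0 : (d : ℂ) ≠ 0 := by exact_mod_cast (by omega : d ≠ 0)
    simp only [hF]
    rw [e1, hΨl, e2, Complex.exp_sub, hρl]
    field_simp
  · have h1 : Set.MapsTo (fun u : ℂ => u * l) (hStrip (α / l) (β / l)) (hStrip α β) := fun u hu => by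
      have h2 : (u * l).im = u.im * l := Complex.im_mul_ofReal u l
      exact ⟨by rw [h2]; exact (div_lt_iff₀ hl).1 hu.1, by rw [h2]; exact (lt_div_iff₀ hl).1 hu.2⟩
    have h3 : DifferentiableOn ℂ (fun u : ℂ => u * l) (hStrip (α / l) (β / l)) := by fun_prop
    exact (Differentiable.differentiableOn (by fun_prop)).mul (hΨd.comp h3 h1)
  · intro s hs
    rw [hE]
    exact hΨre s hs
  · intro α' β' hα' hβ'
    obtain ⟨r, hr⟩ := hconst α' β' hα' hβ'
    refine ⟨Real.exp r, fun s h1 h2 h3 E hEs => ?_⟩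
    rw [Complex.norm_exp, Real.exp_lt_exp] at h3
    rw [hE] at hEs
    obtain ⟨h4, h5⟩ := hr s h1 h2 h3.le
    have h6 := hR₂ (hΩR s h4)
    rw [← hEs] at h5
    rw [h5] at h6
    have h7 : R < ‖ζ * Complex.exp E‖ := (le_max_right 1 R).trans_lt h6.2.2.1
    have h8 : f (Complex.exp s) = ginv (ζ * Complex.exp E) := h6.2.2.2.1.symm
    refine ⟨?_, h7, h8⟩
    rw [h8]
    refine ((hinv' _ h7).2).congr_fun fun n => ?_
    rw [mul_pow, div_eq_mul_inv, mul_inv, ← Complex.exp_nat_mul, ← Complex.exp_neg, neg_mul,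
      mul_assoc]
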